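/- Let $n\ge 2$ and let $P=v_0v_1\cdots v_n$ be a path of length $n$ (the attack path, with victim $v_0$ and attacker $v_n$) in a graph (the network), with edges $e_j=\{v_{j-1},v_j\}$, $1\le j\le n$. Let $p=1/n$. The victim receives a sequence of independent packets; each packet is marked by the edge $e_j$ with probability $p(1-p)^{j-1}$, $1\le j\le n$, and is unmarked with probability $(1-p)^n$. Let $G$ be the set of edges received so far. A full subpath is a subpath $P'$ of $P$ that starts at $v_0$ and has all its edges in $G$, such that no other edge of $G$ belongs to a path of the network that contains $P'$. The Basic Algorithm starts with $G=\emptyset$ and, as long as $G$ contains no full subpath of length at least $2$, receives the next packet and adds its edge (if it is marked) to $G$; when it stops, it returns the full subpath $P'$ of length at least $2$ contained in $G$. 1. Let $A$ be the event that the Basic Algorithm stops and returns the whole path $P$. As $n\to\infty$, $$P(A)=1-O\!\left(\frac{(\log n)^{1/(e-1)}}{n^{1/e-1/e^2}}\right)=1-o(1).$$ 2. Let $T_1$ be the expected number of packets received until the Basic Algorithm stops, and let $H_n=1+\frac12+\cdots+\frac1n$. Then, for every $n\ge 2$, $$T_1\le e\,n\,H_n=e\,n\log n+O(n).$$ The constant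 in each $O(\cdot)$ is absolute. -/

import Mathlib

open MeasureTheory ProbabilityTheory Filter Asymptotics

open scoped ENNReal

universe u v

namespace PPM

/-- A flow of packets towards the victim, on an attack path with `n` edges and marking probability
`p`: independent identically distributed packets `X 0, X 1, …`, where `X t = j` with `1 ≤ j ≤ n`
means that packet `t` is marked by the edge `e_j`, which is `j` hops from the victim, and
`X t = 0` means that packet `t` is unmarked (the dummy edge `e_0`). -/
structure IsFlow {n : ℕ} {Ω : Type v} [MeasurableSpace Ω] (p : ℝ) (μ : Measure Ω)
    (X : ℕ → Ω → Fin (n + 1)) : Prop where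
  measurable : ∀ t, Measurable (X t)
  indep : iIndepFun X μ
  prob_dummy : ∀ t, μ.real {ω | X t ω = 0} = (1 - p) ^ n
  prob_proper : ∀ t, ∀ j : Fin (n + 1), j ≠ 0 →
    μ.real {ω | X t ω = j} = p * (1 - p) ^ ((j : ℕ) - 1)

variable {V : Type u} {N : SimpleGraph V} {v₀ vₙ : V}

/-- The `j`-th edge `e_j = {v_{j-1}, v_j}` of the path `P = v₀ v₁ … vₙ`, for `1 ≤ j ≤ n`. -/
def edgeAt (P : N.Walk v₀ vₙ) (j : ℕ) : Sym2 V :=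
  s(P.getVert (j - 1), P.getVert j)

/-- The set of edges (the graph `G` of the algorithm) which the victim has after receiving
the packets `x 0, …, x (t - 1)`. -/
def collected {n : ℕ} (P : N.Walk v₀ vₙ) (x : ℕ → Fin (n + 1)) : ℕ → Set (Sym2 V)
  | 0 => ∅
  | t + 1 => if x t = 0 then collected P x t
      else insert (edgeAt P (x t : ℕ)) (collected P x t)

/-- `P'` is a full subpath of the attack path `P`, contained in the collected graph `G`:
it is a subpath of `P` starting at the victim `v₀`, all its edges are in `G`, and no other edge
of `G` belongs to a path of the network `N` that contains `P'`. -/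
structure IsFullSubpath (P : N.Walk v₀ vₙ) (G : Set (Sym2 V)) {w : V} (P' : N.Walk v₀ w) :
    Prop where
  isPrefix : ∃ R : N.Walk w vₙ, P = P'.append R
  subset : ∀ e ∈ P'.edges, e ∈ G
  full : ∀ e ∈ G, e ∉ P'.edges →
    ¬ ∃ (a b : V) (Q : N.Walk a b), Q.IsPath ∧ (∀ f ∈ P'.edges, f ∈ Q.edges) ∧ e ∈ Q.edges

/-- The condition that ends the loop of the Basic Algorithm: `G` contains a full subpath of
length at least `2`. -/
def HasFullSubpath (P : N.Walk v₀ vₙ) (G : Set (Sym2 V)) : Prop :=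
  ∃ (w : V) (P' : N.Walk v₀ w), 2 ≤ P'.length ∧ IsFullSubpath P G P'

/-- On the flow `x`, the Basic Algorithm stops and returns `P'`: at some time `t` the loop ends for
the first time, and `P'` is then a full subpath of length at least `2`. -/
def Returns {n : ℕ} (P : N.Walk v₀ vₙ) (x : ℕ → Fin (n + 1)) {w : V} (P' : N.Walk v₀ w) : Prop :=
  ∃ t : ℕ, (∀ s < t, ¬ HasFullSubpath P (collected P x s)) ∧
    2 ≤ P'.length ∧ IsFullSubpath P (collected P x t) P'

/-- The number of packets that the Basic Algorithm receives before it stops on the flow `x`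
(`⊤` if it never stops). -/
noncomputable def stoppingTime {n : ℕ} (P : N.Walk v₀ vₙ) (x : ℕ → Fin (n + 1)) : ℕ∞ :=
  ⨅ (t : ℕ) (_ : HasFullSubpath P (collected P x t)), (t : ℕ∞)

/-- The rate `(log n)^{1/(e-1)} / n^{1/e - 1/e²}`. -/
noncomputable def rate (n : ℕ) : ℝ :=
  Real.log n ^ (1 / (Real.exp 1 - 1)) / (n : ℝ) ^ (1 / Real.exp 1 - 1 / Real.exp 1 ^ 2)

end PPM

/-!
The attack path is itself a path of the network, so a full subpath can exist only when the
collected edges are exactly those of a prefix `{e_1, …, e_k}` of the path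
(`exists_run_eq_firstHops`). The algorithm is therefore a coupon collector with coupons `1, …, n`
and a dummy: it fails to return the whole path only if the collection passes through some set
`{1, …, k}` with `2 ≤ k < n`, or is never complete.

For `p = 1/n` the largest probability of a coupon is at most `e < 3` times the smallest. While
the collection is contained in `{1, …, k}` and lacks `r` elements of it, the next new coupon is in
`{1, …, k}` with probability at most `3r / (m + 3r)`, where `m = n - k`. Hence the collection passes
through `{1, …, k}` with probability at most `∏_{r=1}^k 3r / (m + 3r)`; this product is made into a
supermartingale in `drift_gatherUntil` and `measure_exists_run_eq_le`. By Bernoulli's inequality its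
cube is at most `1 / n.choose k` (`passBound_cube_mul_choose_le`), and the sum over `k` of the cube
roots is `O(n^{-1/3})` (`sum_passBound_le`). Since `1/e - 1/e² ≤ 1/4 < 1/3`, this is better than the
claimed rate.

The stopping time is at most the completion time of the coupon collector. Every coupon has
probability at least `1/(e n)`, so the potential `e n H_r`, where `r` is the number of missing
coupons, decreases by at least `1` per packet on average (`drift_gather`). Both potential arguments
are instances of `integral_add_sum_le_of_drift`.
-/

namespace PPM

/-! ### States of the algorithm as sets of hops -/

section Hops

/-- The state reached after `t` letters of `x` by the automaton with transition map `step` that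
starts in the state `s`. -/
def run {σ α : Type*} (step : σ → α → σ) (s : σ) (x : ℕ → α) : ℕ → σ
  | 0 => s
  | t + 1 => step (run step s x t) (x t)

lemma run_congr {σ α : Type*} (step : σ → α → σ) (s : σ) {x y : ℕ → α} :
    ∀ {t : ℕ}, (∀ i < t, x i = y i) → run step s x t = run step s y t
  | 0, _ => rfl
  | t + 1, h => by
    rw [run, run, run_congr step s fun i hi => h i (hi.trans t.lt_succ_self), h t t.lt_succ_self]

variable {n : ℕ}

/-- One step of the coupon collector with coupons `1, …, n` and the dummy `0`. -/
def gather (S : Finset (Fin (n + 1))) (j : Fin (n + 1)) : Finset (Fin (n + 1)) :=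
  if j = 0 then S else insert j S

/-- The set `{1, …, k}` of the `k` hops nearest to the victim. -/
def firstHops (n k : ℕ) : Finset (Fin (n + 1)) :=
  Finset.univ.filter fun j => 0 < (j : ℕ) ∧ (j : ℕ) ≤ k

lemma mem_firstHops {k : ℕ} {j : Fin (n + 1)} :
    j ∈ firstHops n k ↔ 0 < (j : ℕ) ∧ (j : ℕ) ≤ k := by
  simp [firstHops]

lemma mem_firstHops_self {j : Fin (n + 1)} : j ∈ firstHops n n ↔ j ≠ 0 := by
  rw [mem_firstHops, ← Fin.pos_iff_ne_zero, Fin.lt_def]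
  exact and_iff_left (Nat.lt_succ_iff.1 j.isLt)

lemma firstHops_subset {k : ℕ} : firstHops n k ⊆ firstHops n n := fun j hj => by
  rw [mem_firstHops] at *
  have := j.isLt
  omega

lemma card_firstHops {k : ℕ} (hk : k ≤ n) : (firstHops n k).card = k := by
  have h : (firstHops n k).map Fin.valEmbedding = Finset.Ioc 0 k := by
    ext i
    simp only [Finset.mem_map, mem_firstHops, Fin.valEmbedding_apply, Finset.mem_Ioc]
    constructor
    · rintro ⟨j, hj, rfl⟩
      exact hj
    · intro hi
      exact ⟨⟨i, by omega⟩, hi, rfl⟩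
  rw [← Finset.card_map, h, Nat.card_Ioc, Nat.sub_zero]

lemma subset_gather (S : Finset (Fin (n + 1))) (j : Fin (n + 1)) : S ⊆ gather S j := by
  unfold gather
  split_ifs
  · exact subset_rfl
  · exact Finset.subset_insert _ _

lemma zero_notMem_run_gather (x : ℕ → Fin (n + 1)) (t : ℕ) :
    (0 : Fin (n + 1)) ∉ run gather ∅ x t := by
  induction t with
  | zero => simp [run]
  | succ t ih =>
    rw [run, gather]
    split_ifs with h
    · exact ih
    · simpa [Finset.mem_insert, ih] using Ne.symm h

/-! ### Full subpaths of the attack path -/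

section FullSubpath

variable {V : Type u} {N : SimpleGraph V} {v₀ vₙ : V} {P : N.Walk v₀ vₙ}

lemma collected_eq_image (P : N.Walk v₀ vₙ) (x : ℕ → Fin (n + 1)) (t : ℕ) :
    collected P x t = (fun j : Fin (n + 1) => edgeAt P j) ''
      ((run gather ∅ x t : Finset (Fin (n + 1))) : Set (Fin (n + 1))) := by
  induction t with
  | zero => simp [collected, run]
  | succ t ih =>
    rw [collected, run, gather, ih]
    split_ifs
    · rfl
    · rw [Finset.coe_insert, Set.image_insert_eq]

lemma edges_getElem_eq_edgeAt (P : N.Walk v₀ vₙ) {j : ℕ} (hj : 0 < j)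
    (h : j - 1 < P.edges.length) : P.edges[j - 1] = edgeAt P j := by
  rw [SimpleGraph.Walk.getElem_edges, edgeAt, Nat.sub_add_cancel hj]

/-- Since a path repeats no edge, its edge `e_j` lies on a given prefix only if `j` is at most the
length of the prefix. -/
lemma edgeAt_mem_edges_iff {w : V} {P' : N.Walk v₀ w} {R : N.Walk w vₙ} (hP : P.IsPath)
    (hR : P = P'.append R) {j : ℕ} (hj : 0 < j) (hjn : j ≤ P.length) :
    edgeAt P j ∈ P'.edges ↔ j ≤ P'.length := by
  have hE : P.edges = P'.edges ++ R.edges := by rw [hR, SimpleGraph.Walk.edges_append]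
  have hnd : (P'.edges ++ R.edges).Nodup := hE ▸ hP.isTrail.edges_nodup
  have hlt : j - 1 < P.edges.length := by
    rw [SimpleGraph.Walk.length_edges]
    omega
  have hlt' : j - 1 < (P'.edges ++ R.edges).length := hE ▸ hlt
  have hget : (P'.edges ++ R.edges)[j - 1] = edgeAt P j := by
    rw [← edges_getElem_eq_edgeAt P hj hlt]
    simp only [hE]
  rw [← hget]
  by_cases h : j ≤ P'.length
  · have h' : j - 1 < P'.edges.length := by
      rw [SimpleGraph.Walk.length_edges]
      omega
    rw [List.getElem_append_left h']
    simp [h]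
  · have h' : P'.edges.length ≤ j - 1 := by
      rw [SimpleGraph.Walk.length_edges]
      omega
    rw [List.getElem_append_right h']
    simp only [h, iff_false]
    intro hmem
    exact (List.nodup_append'.1 hnd).2.2 hmem (List.getElem_mem _)

/-- The attack path itself is a path of the network through every prefix `P'` and through every
collected edge, so a full subpath contains all the collected edges: they are exactly its own. -/
lemma exists_run_eq_firstHops (hP : P.IsPath) (hn : P.length = n) {x : ℕ → Fin (n + 1)} {t : ℕ}
    (h : HasFullSubpath P (collected P x t)) :
    ∃ k, 2 ≤ k ∧ k ≤ n ∧ run gather ∅ x t = firstHops n k := by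
  obtain ⟨w, P', hlen, ⟨R, hR⟩, hsub, hfull⟩ := h
  have hle : P'.length ≤ n := by
    rw [← hn, hR, SimpleGraph.Walk.length_append]
    omega
  have hP' : ∀ e ∈ P'.edges, e ∈ P.edges := fun e he => by
    rw [hR, SimpleGraph.Walk.edges_append]
    exact List.mem_append_left _ he
  refine ⟨P'.length, hlen, hle, ?_⟩
  ext j
  rw [mem_firstHops]
  have hjn : (j : ℕ) ≤ P.length := (Nat.lt_succ_iff.1 j.isLt).trans hn.ge
  constructor
  · intro hj
    have hj0 : 0 < (j : ℕ) := by
      rcases Nat.eq_zero_or_pos (j : ℕ) with h0 | h0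
      · rw [show j = 0 from Fin.ext h0] at hj
        exact absurd hj (zero_notMem_run_gather x t)
      · exact h0
    refine ⟨hj0, ?_⟩
    rw [← edgeAt_mem_edges_iff hP hR hj0 hjn]
    by_contra hmem
    refine hfull (edgeAt P j) ?_ hmem ⟨v₀, vₙ, P, hP, hP', ?_⟩
    · rw [collected_eq_image]
      exact ⟨j, hj, rfl⟩
    · rw [← edges_getElem_eq_edgeAt P hj0
        (by rw [SimpleGraph.Walk.length_edges]; omega)]
      exact List.getElem_mem _
  · rintro ⟨hj0, hj⟩
    have hmem := hsub _ ((edgeAt_mem_edges_iff hP hR hj0 hjn).2 hj)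
    rw [collected_eq_image] at hmem
    obtain ⟨i, hi, hij⟩ := hmem
    have hi0 : 0 < (i : ℕ) := by
      rcases Nat.eq_zero_or_pos (i : ℕ) with h0 | h0
      · rw [show i = 0 from Fin.ext h0] at hi
        exact absurd hi (zero_notMem_run_gather x t)
      · exact h0
    have hin : (i : ℕ) ≤ P.length := (Nat.lt_succ_iff.1 i.isLt).trans hn.ge
    have hlen' := SimpleGraph.Walk.length_edges P
    have hinj : (i : ℕ) - 1 = (j : ℕ) - 1 := by
      rw [← hP.isTrail.edges_nodup.getElem_inj_iff (hi := by omega) (hj := by omega),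
        edges_getElem_eq_edgeAt P hi0, edges_getElem_eq_edgeAt P hj0]
      exact hij
    rwa [show j = i from Fin.ext (by omega)]

lemma isFullSubpath_self (hn : P.length = n) {x : ℕ → Fin (n + 1)} {t : ℕ}
    (h : run gather ∅ x t = firstHops n n) : IsFullSubpath P (collected P x t) P := by
  have hG : ∀ e, e ∈ collected P x t ↔ e ∈ P.edges := by
    intro e
    have hlen := SimpleGraph.Walk.length_edges P
    rw [collected_eq_image, h, List.mem_iff_getElem]
    constructor
    · rintro ⟨j, hj, rfl⟩
      rw [Finset.mem_coe, mem_firstHops] at hj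
      exact ⟨j - 1, by omega, edges_getElem_eq_edgeAt P hj.1 _⟩
    · rintro ⟨i, hi, rfl⟩
      refine ⟨⟨i + 1, by omega⟩, ?_, (edges_getElem_eq_edgeAt P i.succ_pos _).symm⟩
      rw [Finset.mem_coe, mem_firstHops]
      exact ⟨i.succ_pos, by simp; omega⟩
  exact ⟨⟨.nil, by simp⟩, fun e he => (hG e).2 he, fun e he he' => absurd ((hG e).1 he) he'⟩

lemma returns_self (hP : P.IsPath) (hn : P.length = n) (hn2 : 2 ≤ n) {x : ℕ → Fin (n + 1)}
    (hall : ∃ t, run gather ∅ x t = firstHops n n)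
    (hbad : ∀ k ∈ Finset.Ico 2 n, ∀ t, run gather ∅ x t ≠ firstHops n k) : Returns P x P := by
  classical
  refine ⟨Nat.find hall, fun s hs hfull => ?_, hn.symm ▸ hn2,
    isFullSubpath_self hn (Nat.find_spec hall)⟩
  obtain ⟨k, hk2, hkn, hk⟩ := exists_run_eq_firstHops hP hn hfull
  rcases hkn.lt_or_eq with hlt | rfl
  · exact hbad k (Finset.mem_Ico.2 ⟨hk2, hlt⟩) s hk
  · exact Nat.find_min hall hs hk

/-- The algorithm stops not later than the coupon collector, whose completion time is the number
of times at which the collection is incomplete. -/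
lemma stoppingTime_le_tsum (hn : P.length = n) (hn2 : 2 ≤ n) (x : ℕ → Fin (n + 1)) :
    (stoppingTime P x : ℝ≥0∞) ≤
      ∑' t, if firstHops n n \ run gather ∅ x t = ∅ then 0 else 1 := by
  classical
  by_cases hall : ∃ t, firstHops n n \ run gather ∅ x t = ∅
  · have hτ : stoppingTime P x ≤ (Nat.find hall : ℕ∞) := by
      refine iInf₂_le _ ⟨vₙ, P, hn.symm ▸ hn2, isFullSubpath_self hn ?_⟩
      refine Finset.Subset.antisymm (fun j hj => mem_firstHops_self.2 ?_)
        (Finset.sdiff_eq_empty_iff_subset.1 (Nat.find_spec hall))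
      rintro rfl
      exact zero_notMem_run_gather x _ hj
    calc (stoppingTime P x : ℝ≥0∞) ≤ ((Nat.find hall : ℕ∞) : ℝ≥0∞) := by exact_mod_cast hτ
      _ = ∑ t ∈ Finset.range (Nat.find hall),
            if firstHops n n \ run gather ∅ x t = ∅ then (0 : ℝ≥0∞) else 1 := by
          rw [Finset.sum_congr rfl fun t ht =>
            if_neg (Nat.find_min hall (Finset.mem_range.1 ht))]
          simp
      _ ≤ _ := ENNReal.sum_le_tsum _
  · simp only [not_exists] at hall
    simp [hall]

end FullSubpath

end Hops

/-! ### Potential functions of an automaton that reads independent letters -/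

section Drift

variable {σ α Ω : Type*} [Fintype α] [MeasurableSpace α] [DiscreteMeasurableSpace α]
  [MeasurableSpace Ω] {μ : Measure Ω} [IsProbabilityMeasure μ] {X : ℕ → Ω → α}

lemma measurable_run [Finite σ] [MeasurableSpace σ] [DiscreteMeasurableSpace σ]
    (hX : ∀ t, Measurable (X t)) (step : σ → α → σ) (s : σ) (t : ℕ) :
    Measurable fun ω => run step s (fun i => X i ω) t := by
  induction t with
  | zero => exact measurable_const
  | succ t ih => exact (measurable_of_finite fun z : σ × α => step z.1 z.2).comp (ih.prodMk (hX t))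

lemma indepFun_run [MeasurableSpace σ] [DiscreteMeasurableSpace σ]
    (hX : ∀ t, Measurable (X t)) (hind : iIndepFun X μ) (step : σ → α → σ) (s : σ) (t : ℕ) :
    IndepFun (fun ω => run step s (fun i => X i ω) t) (X t) μ := by
  classical
  obtain ⟨ω₀⟩ : Nonempty Ω := nonempty_of_isProbabilityMeasure μ
  have h := hind.indepFun_finset (Finset.range t) {t} (by simp) hX
  let F : (Finset.range t → α) → σ := fun y =>
    run step s (fun i => if hi : i ∈ Finset.range t then y ⟨i, hi⟩ else X i ω₀) t
  have hF := h.comp (φ := F) (ψ := fun y => y ⟨t, Finset.mem_singleton_self t⟩)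
    (measurable_of_finite _) (measurable_of_finite _)
  have hrun : (fun ω => run step s (fun i => X i ω) t) = F ∘ fun ω (i : Finset.range t) => X i ω :=
    funext fun ω => run_congr step s fun i hi => by simp [hi]
  rw [hrun]
  exact hF

lemma integral_run_succ [Finite σ] [MeasurableSpace σ] [DiscreteMeasurableSpace σ]
    (hX : ∀ t, Measurable (X t)) (hind : iIndepFun X μ) {q : α → ℝ}
    (hq : ∀ t j, μ.real {ω | X t ω = j} = q j) (step : σ → α → σ) (s : σ) (φ : σ → ℝ) (t : ℕ) :
    ∫ ω, φ (run step s (fun i => X i ω) (t + 1)) ∂μ =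
      ∫ ω, ∑ j, q j * φ (step (run step s (fun i => X i ω) t) j) ∂μ := by
  have hZ := measurable_run hX step s t
  have hprod := (indepFun_run hX hind step s t).map_prod_eq_prod_map_map hZ.aemeasurable
    (hX t).aemeasurable
  have : IsProbabilityMeasure (μ.map fun ω => run step s (fun i => X i ω) t) :=
    Measure.isProbabilityMeasure_map hZ.aemeasurable
  have : IsProbabilityMeasure (μ.map (X t)) :=
    Measure.isProbabilityMeasure_map (hX t).aemeasurable
  have hreal : ∀ j, (μ.map (X t)).real {j} = q j := fun j => by
    rw [map_measureReal_apply (hX t) (measurableSet_singleton j), ← hq t j]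
    rfl
  calc ∫ ω, φ (run step s (fun i => X i ω) (t + 1)) ∂μ
      = ∫ z, φ (step z.1 z.2) ∂(μ.map fun ω => (run step s (fun i => X i ω) t, X t ω)) := by
        rw [integral_map (hZ.prodMk (hX t)).aemeasurable
          (measurable_of_finite _).aestronglyMeasurable]
        rfl
    _ = ∫ z, ∫ j, φ (step z j) ∂(μ.map (X t))
          ∂(μ.map fun ω => run step s (fun i => X i ω) t) := by
        rw [hprod, integral_prod _ Integrable.of_finite]
    _ = ∫ z, ∑ j, q j * φ (step z j) ∂(μ.map fun ω => run step s (fun i => X i ω) t) := by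
        refine integral_congr_ae (ae_of_all _ fun z => ?_)
        simp only [integral_fintype Integrable.of_finite, hreal, smul_eq_mul]
    _ = _ := integral_map hZ.aemeasurable (measurable_of_finite _).aestronglyMeasurable

/-- If one random step decreases the potential `φ` by at least the cost `ψ` on average, then the
expected total cost is at most the initial potential. -/
lemma integral_add_sum_le_of_drift [Finite σ] [MeasurableSpace σ] [DiscreteMeasurableSpace σ]
    (hX : ∀ t, Measurable (X t)) (hind : iIndepFun X μ) {q : α → ℝ}
    (hq : ∀ t j, μ.real {ω | X t ω = j} = q j) (step : σ → α → σ) (s : σ) {φ ψ : σ → ℝ}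
    (hdrift : ∀ z, ∑ j, q j * φ (step z j) + ψ z ≤ φ z) (T : ℕ) :
    ∫ ω, φ (run step s (fun i => X i ω) T) ∂μ +
      ∑ t ∈ Finset.range T, ∫ ω, ψ (run step s (fun i => X i ω) t) ∂μ ≤ φ s := by
  have hint : ∀ (f : σ → ℝ) (t : ℕ), Integrable (fun ω => f (run step s (fun i => X i ω) t)) μ :=
    fun f t => (Integrable.of_finite (f := f)).comp_measurable (measurable_run hX step s t)
  induction T with
  | zero => simp [run]
  | succ T ih =>
    refine le_trans ?_ ih
    rw [Finset.sum_range_succ, add_left_comm, add_comm (∫ ω, φ _ ∂μ), add_comm (∫ ω, φ _ ∂μ)]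
    refine add_le_add le_rfl ?_
    rw [integral_run_succ hX hind hq, add_comm,
      ← integral_add (hint (fun z => ∑ j, q j * φ (step z j)) T) (hint ψ T)]
    exact integral_mono ((hint (fun z => ∑ j, q j * φ (step z j)) T).add (hint ψ T)) (hint φ T)
      fun ω => hdrift _

lemma sum_letterProb (hX : ∀ t, Measurable (X t)) {q : α → ℝ}
    (hq : ∀ t j, μ.real {ω | X t ω = j} = q j) : ∑ j, q j = 1 := by
  have := Measure.isProbabilityMeasure_map (μ := μ) (hX 0).aemeasurable
  rw [← probReal_univ (μ := μ.map (X 0)), ← Finset.coe_univ, ← sum_measureReal_singleton]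
  refine Finset.sum_congr rfl fun j _ => ?_
  rw [map_measureReal_apply (hX 0) (measurableSet_singleton j), ← hq 0 j]
  rfl

end Drift

/-! ### Passing through a given set of coupons -/

/-- The collector of coupons, frozen as soon as its collection is exactly `K`. -/
def gatherUntil {n : ℕ} (K S : Finset (Fin (n + 1))) (j : Fin (n + 1)) : Finset (Fin (n + 1)) :=
  if S = K then K else gather S j

lemma run_gatherUntil_eq {n : ℕ} {K : Finset (Fin (n + 1))} {x : ℕ → Fin (n + 1)} {s t : ℕ}
    (hst : s ≤ t) (hs : run gather ∅ x s = K) : run (gatherUntil K) ∅ x t = K := by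
  have key : ∀ t, run (gatherUntil K) ∅ x t = K ∨
      run (gatherUntil K) ∅ x t = run gather ∅ x t ∧ ∀ s < t, run gather ∅ x s ≠ K := by
    intro t
    induction t with
    | zero => exact .inr ⟨rfl, by simp⟩
    | succ t ih =>
      rw [run, gatherUntil]
      split_ifs with h
      · exact .inl rfl
      · obtain ⟨h1, h2⟩ := ih.resolve_left h
        refine .inr ⟨by rw [h1, run], fun s hs => ?_⟩
        rcases Nat.lt_succ_iff_lt_or_eq.1 hs with h3 | rfl
        · exact h2 s h3
        · exact h1 ▸ h
  rcases key t with h | ⟨h1, h2⟩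
  · exact h
  · rcases hst.lt_or_eq with h | rfl
    · exact absurd hs (h2 s h)
    · exact h1.trans hs

lemma sdiff_gather {n : ℕ} {D : Finset (Fin (n + 1))} (hD : D ⊆ firstHops n n)
    (S : Finset (Fin (n + 1))) (j : Fin (n + 1)) : D \ gather S j = (D \ S).erase j := by
  unfold gather
  split_ifs with h
  · refine (Finset.erase_eq_of_notMem fun hj => ?_).symm
    exact mem_firstHops_self.1 (hD (Finset.sdiff_subset hj)) h
  · exact Finset.sdiff_insert D S j

/-- `∏_{r=1}^k 3r / (m + 3r)`. When the probabilities of the coupons are within a factor `3` of each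
other, `3r / (m + 3r)` bounds the probability that the next new coupon is among `r` given ones
and not among `m` others. -/
noncomputable def passBound (m k : ℕ) : ℝ :=
  ∏ i ∈ Finset.range k, 3 * ((i : ℝ) + 1) / (m + 3 * ((i : ℝ) + 1))

lemma passBound_pos (m k : ℕ) : 0 < passBound m k :=
  Finset.prod_pos fun i _ => by positivity

lemma passBound_sub (m k : ℕ) :
    passBound m k - passBound m (k + 1) = passBound m (k + 1) * (m / (3 * ((k : ℝ) + 1))) := by
  rw [passBound, passBound, Finset.prod_range_succ]
  field_simp
  ring

/-- By Bernoulli's inequality the cube of `r / (r + m/3)` is at most `r / (r + m)`, and the product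
of the latter is the reciprocal of a binomial coefficient. -/
lemma passBound_cube_mul_choose_le (m k : ℕ) : passBound m k ^ 3 * (m + k).choose k ≤ 1 := by
  induction k with
  | zero => simp [passBound]
  | succ k ih =>
    have hC : ((m + (k + 1)).choose (k + 1) : ℝ) =
        (m + k).choose k * ((m + (k + 1) : ℝ) / (k + 1)) := by
      have h := Nat.add_one_mul_choose_eq (m + k) k
      rw [← mul_div_assoc, eq_div_iff (by positivity), mul_comm _ (m + (k + 1) : ℝ)]
      exact_mod_cast h.symm
    have hf : (3 * ((k : ℝ) + 1) / (m + 3 * ((k : ℝ) + 1))) ^ 3 *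
        ((m + (k + 1) : ℝ) / (k + 1)) ≤ 1 := by
      rw [div_pow, div_mul_div_comm, div_le_one (by positivity)]
      have hm : (0 : ℝ) ≤ m := m.cast_nonneg
      have hk : (0 : ℝ) < (k : ℝ) + 1 := by positivity
      generalize (k : ℝ) + 1 = r at *
      -- the difference of the two sides after clearing denominators
      have h0 : (0 : ℝ) ≤ 9 * m ^ 2 * r ^ 2 + m ^ 3 * r := by positivity
      nlinarith
    rw [passBound, Finset.prod_range_succ, ← passBound, hC, mul_pow]
    calc _ = (passBound m k ^ 3 * (m + k).choose k) *
          ((3 * ((k : ℝ) + 1) / (m + 3 * ((k : ℝ) + 1))) ^ 3 * ((m + (k + 1) : ℝ) / (k + 1))) := by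
            ring
      _ ≤ 1 := mul_le_one₀ ih (by positivity) hf

section Collector

variable {n : ℕ} {q : Fin (n + 1) → ℝ} {a : ℝ}

/-- A coupon of `K` raises the potential by the factor `1 + m / 3r`, a coupon outside `K` sends it
to `0`, and the bounds on the probabilities of the coupons make the second effect at least as strong
as the first. The `0` added on the left is the cost in the sense of
`integral_add_sum_le_of_drift`. -/
lemma drift_gatherUntil {K : Finset (Fin (n + 1))} (hK : K ⊆ firstHops n n) (hsum : ∑ j, q j = 1)
    (hlow : ∀ j ≠ 0, a ≤ q j) (hup : ∀ j ≠ 0, q j ≤ 3 * a) (S : Finset (Fin (n + 1))) :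
    (∑ j, q j * if gatherUntil K S j ⊆ K then
      passBound (firstHops n n \ K).card (K \ gatherUntil K S j).card else 0) + 0 ≤
    if S ⊆ K then passBound (firstHops n n \ K).card (K \ S).card else 0 := by
  rw [add_zero]
  by_cases hSK : S = K
  · simp [gatherUntil, hSK, ← Finset.sum_mul, hsum]
  simp only [gatherUntil, if_neg hSK]
  by_cases hsub : S ⊆ K
  swap
  · rw [if_neg hsub]
    refine (Finset.sum_eq_zero fun j _ => ?_).le
    rw [if_neg fun h => hsub ((subset_gather S j).trans h), mul_zero]
  rw [if_pos hsub]
  set m := (firstHops n n \ K).card with hm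
  obtain ⟨r, hr⟩ : ∃ r, (K \ S).card = r + 1 := by
    refine Nat.exists_eq_succ_of_ne_zero fun h => hSK ?_
    exact hsub.antisymm (Finset.sdiff_eq_empty_iff_subset.1 (Finset.card_eq_zero.1 h))
  rw [hr]
  have hterm : ∀ j, (q j * if gather S j ⊆ K then passBound m (K \ gather S j).card else 0) =
      q j * passBound m (r + 1) +
        (if j ∈ K \ S then q j * (passBound m r - passBound m (r + 1)) else 0) -
        (if j ∈ firstHops n n \ K then q j * passBound m (r + 1) else 0) := by
    intro j
    rw [sdiff_gather hK]
    by_cases h1 : j ∈ K \ S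
    · have h2 : j ∉ firstHops n n \ K := fun h => (Finset.mem_sdiff.1 h).2 (Finset.mem_sdiff.1 h1).1
      have h3 : gather S j ⊆ K := by
        unfold gather
        split_ifs
        · exact hsub
        · exact Finset.insert_subset (Finset.mem_sdiff.1 h1).1 hsub
      rw [if_pos h1, if_neg h2, if_pos h3, Finset.card_erase_of_mem h1, hr, Nat.add_sub_cancel]
      ring
    · rw [if_neg h1, Finset.erase_eq_of_notMem h1, hr]
      by_cases h2 : j ∈ firstHops n n \ K
      · rw [if_pos h2, if_neg, mul_zero, add_zero, sub_self]
        intro h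
        rw [gather, if_neg (mem_firstHops_self.1 (Finset.mem_sdiff.1 h2).1)] at h
        exact (Finset.mem_sdiff.1 h2).2 (h (Finset.mem_insert_self j S))
      · rw [if_neg h2, if_pos, add_zero, sub_zero]
        unfold gather
        split_ifs with h0
        · exact hsub
        · refine Finset.insert_subset ?_ hsub
          by_contra hj
          exact h2 (Finset.mem_sdiff.2 ⟨mem_firstHops_self.2 h0, hj⟩)
  rw [Finset.sum_congr rfl fun j _ => hterm j, Finset.sum_sub_distrib, Finset.sum_add_distrib,
    ← Finset.sum_mul, hsum, one_mul, Finset.sum_ite_mem, Finset.sum_ite_mem, Finset.univ_inter,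
    Finset.univ_inter, ← Finset.sum_mul, ← Finset.sum_mul, passBound_sub]
  have hg := passBound_pos m (r + 1)
  have hin : ∑ j ∈ K \ S, q j ≤ 3 * a * (r + 1) := by
    have := Finset.sum_le_card_nsmul (K \ S) q (3 * a) fun j hj =>
      hup j (mem_firstHops_self.1 (hK (Finset.sdiff_subset hj)))
    rw [hr, nsmul_eq_mul] at this
    push_cast at this
    linarith
  have hout : a * m ≤ ∑ j ∈ firstHops n n \ K, q j := by
    have := Finset.card_nsmul_le_sum (firstHops n n \ K) q a fun j hj =>
      hlow j (mem_firstHops_self.1 (Finset.sdiff_subset hj))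
    rw [← hm, nsmul_eq_mul] at this
    linarith
  have h1 : (∑ j ∈ K \ S, q j) * (m / (3 * ((r : ℝ) + 1))) ≤ ∑ j ∈ firstHops n n \ K, q j :=
    calc _ ≤ 3 * a * (r + 1) * (m / (3 * ((r : ℝ) + 1))) := by gcongr
      _ = a * m := by field_simp
      _ ≤ _ := hout
  nlinarith [mul_le_mul_of_nonneg_left h1 hg.le]

variable {Ω : Type*} [MeasurableSpace Ω] {μ : Measure Ω} [IsProbabilityMeasure μ]
  {X : ℕ → Ω → Fin (n + 1)}

/-- If the probabilities of the coupons lie between `a` and `3a`, then the collection passes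
through the set `K` with probability at most `passBound`. The potential is the bound for the
coupons of `K` still to come, or `0` if a coupon outside `K` has come. -/
lemma measure_exists_run_eq_le (hX : ∀ t, Measurable (X t)) (hind : iIndepFun X μ)
    (hq : ∀ t j, μ.real {ω | X t ω = j} = q j) (hlow : ∀ j ≠ 0, a ≤ q j)
    (hup : ∀ j ≠ 0, q j ≤ 3 * a) {K : Finset (Fin (n + 1))} (hK : K ⊆ firstHops n n) :
    μ {ω | ∃ t, run gather ∅ (fun i => X i ω) t = K} ≤
      ENNReal.ofReal (passBound (firstHops n n \ K).card K.card) := by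
  let _ : MeasurableSpace (Finset (Fin (n + 1))) := ⊤
  have : DiscreteMeasurableSpace (Finset (Fin (n + 1))) := ⟨fun _ => trivial⟩
  set B : ℕ → Set Ω := fun t => {ω | run (gatherUntil K) ∅ (fun i => X i ω) t = K}
  have hBmeas : ∀ t, MeasurableSet (B t) := fun t =>
    measurable_run hX (gatherUntil K) ∅ t (measurableSet_singleton K)
  have hBmono : Monotone B := by
    refine monotone_nat_of_le_succ fun t ω hω => ?_
    change run (gatherUntil K) ∅ (fun i => X i ω) (t + 1) = K
    rw [run, gatherUntil, if_pos (show run (gatherUntil K) ∅ (fun i => X i ω) t = K from hω)]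
  have hsub : {ω | ∃ t, run gather ∅ (fun i => X i ω) t = K} ⊆ ⋃ t, B t := by
    rintro ω ⟨t, ht⟩
    exact Set.mem_iUnion.2 ⟨t, run_gatherUntil_eq le_rfl ht⟩
  refine (measure_mono hsub).trans ?_
  rw [hBmono.measure_iUnion]
  refine iSup_le fun t => ?_
  set φ : Finset (Fin (n + 1)) → ℝ := fun S =>
    if S ⊆ K then passBound (firstHops n n \ K).card (K \ S).card else 0 with hφ
  have hdrift := integral_add_sum_le_of_drift hX hind hq (gatherUntil K) ∅ (φ := φ)
    (ψ := fun _ => 0) (drift_gatherUntil hK (sum_letterProb hX hq) hlow hup) t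
  rw [← ofReal_measureReal]
  refine ENNReal.ofReal_le_ofReal ?_
  calc μ.real (B t) = ∫ ω, (B t).indicator 1 ω ∂μ := (integral_indicator_one (hBmeas t)).symm
    _ ≤ ∫ ω, φ (run (gatherUntil K) ∅ (fun i => X i ω) t) ∂μ := by
      refine integral_mono ((integrable_const (1 : ℝ)).indicator (hBmeas t))
        ((Integrable.of_finite (f := φ)).comp_measurable (measurable_run hX _ ∅ t)) fun ω => ?_
      by_cases hω : ω ∈ B t
      · have hω' : run (gatherUntil K) ∅ (fun i => X i ω) t = K := hω
        simp [Set.indicator_of_mem hω, hφ, hω', passBound]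
      · rw [Set.indicator_of_notMem hω]
        simp only [hφ]
        split_ifs
        · exact (passBound_pos _ _).le
        · exact le_rfl
    _ ≤ φ ∅ := by simpa using hdrift
    _ = _ := by simp [hφ]

/-! ### The time of the coupon collector -/

/-- The harmonic potential of a collection that lacks `r` coupons drops by `b / r` when one of them
comes, which has probability at least `r a ≥ r / b`. -/
lemma drift_gather {b : ℝ} (hb : 0 ≤ b) (hab : 1 ≤ a * b) (hsum : ∑ j, q j = 1)
    (hlow : ∀ j ≠ 0, a ≤ q j) (S : Finset (Fin (n + 1))) :
    (∑ j, q j * (b * (harmonic (firstHops n n \ gather S j).card : ℝ))) +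
      (if firstHops n n \ S = ∅ then 0 else 1) ≤
    b * (harmonic (firstHops n n \ S).card : ℝ) := by
  simp only [sdiff_gather subset_rfl]
  by_cases hS : firstHops n n \ S = ∅
  · simp [hS]
  rw [if_neg hS]
  obtain ⟨r, hr⟩ := Nat.exists_eq_succ_of_ne_zero (mt Finset.card_eq_zero.1 hS)
  have hterm : ∀ j, q j * (b * (harmonic ((firstHops n n \ S).erase j).card : ℝ)) =
      q j * (b * (harmonic (r + 1) : ℝ)) -
        if j ∈ firstHops n n \ S then q j * (b / (r + 1)) else 0 := by
    intro j
    split_ifs with h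
    · rw [Finset.card_erase_of_mem h, hr, Nat.succ_sub_one, harmonic_succ]
      push_cast
      ring
    · rw [Finset.erase_eq_of_notMem h, hr, sub_zero]
  rw [Finset.sum_congr rfl fun j _ => hterm j, Finset.sum_sub_distrib, ← Finset.sum_mul, hsum,
    one_mul, Finset.sum_ite_mem, Finset.univ_inter, ← Finset.sum_mul, hr]
  have hW : a * (r + 1) ≤ ∑ j ∈ firstHops n n \ S, q j := by
    have := Finset.card_nsmul_le_sum (firstHops n n \ S) q a fun j hj =>
      hlow j (mem_firstHops_self.1 (Finset.sdiff_subset hj))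
    rw [hr, nsmul_eq_mul] at this
    push_cast at this
    linarith
  have h1 : 1 ≤ (∑ j ∈ firstHops n n \ S, q j) * (b / (r + 1)) :=
    calc 1 ≤ a * b := hab
      _ = a * (r + 1) * (b / (r + 1)) := by field_simp
      _ ≤ _ := by gcongr
  linarith

lemma measurable_incomplete (hX : ∀ t, Measurable (X t)) (t : ℕ) :
    Measurable fun ω =>
      if firstHops n n \ run gather ∅ (fun i => X i ω) t = ∅ then (0 : ℝ≥0∞) else 1 := by
  let _ : MeasurableSpace (Finset (Fin (n + 1))) := ⊤
  have : DiscreteMeasurableSpace (Finset (Fin (n + 1))) := ⟨fun _ => trivial⟩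
  exact (measurable_of_finite fun S : Finset (Fin (n + 1)) =>
    if firstHops n n \ S = ∅ then (0 : ℝ≥0∞) else 1).comp (measurable_run hX gather ∅ t)

/-- The classical bound for the coupon collector: if every coupon has probability at least `1 / b`,
then the expected number of incomplete times is at most `b H_n`. -/
lemma lintegral_tsum_incomplete_le {b : ℝ} (hb : 0 ≤ b) (hab : 1 ≤ a * b)
    (hX : ∀ t, Measurable (X t)) (hind : iIndepFun X μ)
    (hq : ∀ t j, μ.real {ω | X t ω = j} = q j) (hlow : ∀ j ≠ 0, a ≤ q j) :
    ∫⁻ ω, ∑' t, (if firstHops n n \ run gather ∅ (fun i => X i ω) t = ∅ then 0 else 1) ∂μ ≤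
      ENNReal.ofReal (b * (harmonic n : ℝ)) := by
  let _ : MeasurableSpace (Finset (Fin (n + 1))) := ⊤
  have : DiscreteMeasurableSpace (Finset (Fin (n + 1))) := ⟨fun _ => trivial⟩
  set ψ : Finset (Fin (n + 1)) → ℝ := fun S => if firstHops n n \ S = ∅ then 0 else 1 with hψ
  have hψ0 : ∀ S, 0 ≤ ψ S := fun S => by
    simp only [hψ]
    split_ifs <;> norm_num
  have hcost : ∀ t,
      ∫⁻ ω, (if firstHops n n \ run gather ∅ (fun i => X i ω) t = ∅ then 0 else 1) ∂μ =
      ENNReal.ofReal (∫ ω, ψ (run gather ∅ (fun i => X i ω) t) ∂μ) := by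
    intro t
    rw [ofReal_integral_eq_lintegral_ofReal (f := fun ω => ψ (run gather ∅ (fun i => X i ω) t))
      ((Integrable.of_finite (f := ψ)).comp_measurable (measurable_run hX _ ∅ t))
      (ae_of_all _ fun ω => hψ0 _)]
    refine lintegral_congr fun ω => ?_
    simp only [hψ]
    split_ifs <;> simp
  rw [lintegral_tsum fun t => (measurable_incomplete hX t).aemeasurable]
  refine ENNReal.tsum_le_of_sum_range_le fun T => ?_
  rw [Finset.sum_congr rfl fun t _ => hcost t,
    ← ENNReal.ofReal_sum_of_nonneg fun t _ => integral_nonneg fun ω => hψ0 _]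
  refine ENNReal.ofReal_le_ofReal ?_
  have hdrift := integral_add_sum_le_of_drift hX hind hq gather ∅ (ψ := ψ)
    (φ := fun S => b * (harmonic (firstHops n n \ S).card : ℝ))
    (drift_gather hb hab (sum_letterProb hX hq) hlow) T
  rw [Finset.sdiff_empty, card_firstHops le_rfl] at hdrift
  refine le_trans (le_add_of_nonneg_left (integral_nonneg fun ω => mul_nonneg hb ?_)) hdrift
  rw [harmonic]
  push_cast
  positivity

end Collector

/-! ### Numerical estimates -/

lemma choose_le_choose_of_add_le {n c k : ℕ} (hck : c ≤ k) (hk : c + k ≤ n) :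
    n.choose c ≤ n.choose k := by
  have key : ∀ k, c ≤ k → k ≤ n / 2 → n.choose c ≤ n.choose k := by
    intro k hck
    induction k, hck using Nat.le_induction with
    | base => exact fun _ => le_rfl
    | succ k _ ih =>
      exact fun h => (ih (by omega)).trans (Nat.choose_le_succ_of_lt_half_left (by omega))
  by_cases h : k ≤ n / 2
  · exact key k hck h
  · rw [← Nat.choose_symm (by omega : k ≤ n)]
    exact key (n - k) (by omega) (by omega)

lemma pow_four_le_choose_four {n : ℕ} (hn : 8 ≤ n) : (n : ℝ) ^ 4 ≤ 512 * n.choose 4 := by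
  have h := Nat.pow_le_choose (α := ℝ) 4 n
  have h4 : ((Nat.factorial 4 : ℕ) : ℝ) = 24 := by norm_num [Nat.factorial]
  have hn' : (8 : ℝ) ≤ n := by exact_mod_cast hn
  rw [h4, Nat.cast_sub (by omega)] at h
  push_cast at h
  have h1 : (5 / 8 * (n : ℝ)) ^ 4 ≤ ((n : ℝ) + 1 - 4) ^ 4 := by
    gcongr
    linarith
  have h2 : (0 : ℝ) ≤ (n : ℝ) ^ 4 := by positivity
  rw [mul_pow] at h1
  linarith

/-- The values `2, 3, n - 3, n - 2, n - 1` of `k` contribute at most `n^{-1/3}` each, because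
`n.choose k ≥ n`; the others contribute at most `8 n^{-4/3}` each, because
`512 * n.choose k ≥ n⁴`. -/
lemma sum_passBound_le {n : ℕ} (hn : 2 ≤ n) :
    ∑ k ∈ Finset.Ico 2 n, passBound (n - k) k ≤ 13 * (n : ℝ) ^ (-(1 / 3 : ℝ)) := by
  have hn0 : (0 : ℝ) < n := by positivity
  set y : ℝ := (n : ℝ) ^ (-(1 / 3 : ℝ)) with hy
  have hy0 : 0 < y := Real.rpow_pos_of_pos hn0 _
  have hy3 : n * y ^ 3 = 1 := by
    rw [hy, ← Real.rpow_natCast, ← Real.rpow_mul hn0.le]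
    norm_num
    rw [Real.rpow_neg_one, mul_inv_cancel₀ hn0.ne']
  have hcube : ∀ k ≤ n, passBound (n - k) k ^ 3 * n.choose k ≤ 1 := fun k hk => by
    have := passBound_cube_mul_choose_le (n - k) k
    rwa [Nat.sub_add_cancel hk] at this
  have hpt : ∀ k ∈ Finset.Ico 2 n, passBound (n - k) k ≤
      8 * y ^ 4 + if k ∈ ({2, 3, n - 3, n - 2, n - 1} : Finset ℕ) then y else 0 := by
    intro k hk
    rw [Finset.mem_Ico] at hk
    have hc := hcube k hk.2.le
    have hg := passBound_pos (n - k) k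
    split_ifs with h
    · have h1 : (n : ℝ) ≤ n.choose k := by
        have := choose_le_choose_of_add_le (c := 1) (k := k) (n := n) (by omega) (by omega)
        rw [Nat.choose_one_right] at this
        exact_mod_cast this
      have h2 : passBound (n - k) k ≤ y := by
        refine le_of_pow_le_pow_left₀ three_ne_zero hy0.le ?_
        refine le_of_mul_le_mul_left ?_ hn0
        rw [hy3]
        calc _ = passBound (n - k) k ^ 3 * n := mul_comm _ _
          _ ≤ passBound (n - k) k ^ 3 * n.choose k := by gcongr
          _ ≤ 1 := hc
      have : 0 ≤ 8 * y ^ 4 := by positivity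
      linarith
    · simp only [Finset.mem_insert, Finset.mem_singleton, not_or] at h
      have h1 : (n : ℝ) ^ 4 ≤ 512 * n.choose k := by
        refine (pow_four_le_choose_four (by omega)).trans ?_
        gcongr
        exact_mod_cast choose_le_choose_of_add_le (by omega) (by omega)
      rw [add_zero]
      refine le_of_pow_le_pow_left₀ three_ne_zero (by positivity) ?_
      refine le_of_mul_le_mul_left ?_ (pow_pos hn0 4)
      calc (n : ℝ) ^ 4 * passBound (n - k) k ^ 3
          ≤ 512 * n.choose k * passBound (n - k) k ^ 3 := by gcongr
        _ ≤ 512 := by linarith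
        _ = 512 * (n * y ^ 3) ^ 4 := by rw [hy3]; norm_num
        _ = _ := by ring
  calc _ ≤ ∑ k ∈ Finset.Ico 2 n,
        (8 * y ^ 4 + if k ∈ ({2, 3, n - 3, n - 2, n - 1} : Finset ℕ) then y else 0) :=
        Finset.sum_le_sum hpt
    _ ≤ n * (8 * y ^ 4) + 5 * y := by
      rw [Finset.sum_add_distrib, Finset.sum_const, Nat.card_Ico, nsmul_eq_mul,
        Finset.sum_ite_mem, Finset.sum_const, nsmul_eq_mul]
      gcongr
      · omega
      · exact_mod_cast (Finset.card_le_card Finset.inter_subset_right).trans Finset.card_le_five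
    _ = 8 * (n * y ^ 3) * y + 5 * y := by ring
    _ = 13 * y := by rw [hy3]; ring

/-- `1/e - 1/e² = 1/4 - (1/e - 1/2)² < 1/3`. -/
lemma rpow_neg_third_le_rate {n : ℕ} (hn : 2 ≤ n) :
    (n : ℝ) ^ (-(1 / 3 : ℝ)) ≤
      (Real.log 2 ^ (1 / (Real.exp 1 - 1)))⁻¹ * rate n := by
  have hn1 : (1 : ℝ) ≤ n := by exact_mod_cast (by omega : 1 ≤ n)
  have hn2 : (2 : ℝ) ≤ n := by exact_mod_cast hn
  have hlog2 : 0 < Real.log 2 := Real.log_pos (by norm_num)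
  have hpos : 0 < Real.log 2 ^ (1 / (Real.exp 1 - 1)) := Real.rpow_pos_of_pos hlog2 _
  have hexp : 0 ≤ 1 / (Real.exp 1 - 1) := by
    have := Real.add_one_le_exp 1
    exact one_div_nonneg.2 (by linarith)
  have hlog : Real.log 2 ^ (1 / (Real.exp 1 - 1)) ≤ Real.log n ^ (1 / (Real.exp 1 - 1)) :=
    Real.rpow_le_rpow hlog2.le (Real.log_le_log (by norm_num) hn2) hexp
  have hn' : (n : ℝ) ^ (-(1 / 3 : ℝ)) ≤
      ((n : ℝ) ^ (1 / Real.exp 1 - 1 / Real.exp 1 ^ 2))⁻¹ := by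
    rw [← Real.rpow_neg (by linarith)]
    refine Real.rpow_le_rpow_of_exponent_le hn1 (neg_le_neg ?_)
    have := sq_nonneg (1 / Real.exp 1 - 1 / 2)
    rw [← one_div_pow]
    nlinarith
  have hn0 : 0 ≤ ((n : ℝ) ^ (1 / Real.exp 1 - 1 / Real.exp 1 ^ 2))⁻¹ := by positivity
  rw [rate, le_inv_mul_iff₀ hpos, div_eq_mul_inv]
  exact mul_le_mul hlog hn' (by positivity) (hpos.le.trans hlog)

lemma rate_isLittleO_one : rate =o[atTop] fun _ => (1 : ℝ) := by
  have hb : 0 < 1 / Real.exp 1 - 1 / Real.exp 1 ^ 2 := by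
    have h1 : 1 < Real.exp 1 := Real.one_lt_exp_iff.2 one_pos
    rw [sub_pos]
    exact one_div_lt_one_div_of_lt (by positivity) (by nlinarith)
  have h := (isLittleO_log_rpow_rpow_atTop (1 / (Real.exp 1 - 1)) hb).comp_tendsto
    tendsto_natCast_atTop_atTop
  rw [isLittleO_one_iff]
  exact h.tendsto_div_nhds_zero

lemma harmonic_sub_log_isBigO :
    (fun n : ℕ => Real.exp 1 * n * (harmonic n : ℝ) - Real.exp 1 * n * Real.log n)
      =O[atTop] (fun n : ℕ => (n : ℝ)) := by
  refine IsBigO.of_bound (Real.exp 1) ?_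
  filter_upwards [eventually_ge_atTop 1] with n hn
  have hn0 : (0 : ℝ) < n := by exact_mod_cast hn
  have h1 := harmonic_le_one_add_log n
  have h2 : Real.log n ≤ harmonic n := by
    refine le_trans (Real.log_le_log hn0 ?_) (log_add_one_le_harmonic n)
    exact_mod_cast n.le_succ
  rw [← mul_sub, Real.norm_of_nonneg (mul_nonneg (by positivity) (sub_nonneg.2 h2)),
    Real.norm_of_nonneg hn0.le]
  exact mul_le_of_le_one_right (by positivity) (by linarith)

lemma exp_neg_one_le_pow {n : ℕ} (hn : 2 ≤ n) :
    (Real.exp 1)⁻¹ ≤ (1 - 1 / (n : ℝ)) ^ (n - 1) := by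
  have hn2 : (2 : ℝ) ≤ n := by exact_mod_cast hn
  have hpos : 0 < 1 - 1 / (n : ℝ) := by
    rw [sub_pos, div_lt_one (by linarith)]
    linarith
  rw [← Real.exp_neg, ← Real.le_log_iff_exp_le (pow_pos hpos _), Real.log_pow,
    Nat.cast_sub (by omega), Nat.cast_one]
  have h := Real.one_sub_inv_le_log_of_pos hpos
  have h1 : ((n : ℝ) - 1) * (1 - (1 - 1 / (n : ℝ))⁻¹) = -1 := by
    have : (n : ℝ) - 1 ≠ 0 := by linarith
    rw [show 1 - 1 / (n : ℝ) = (n - 1) / n by field_simp]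
    field_simp
    ring
  rw [← h1]
  exact mul_le_mul_of_nonneg_left h (by linarith)

/-! ### The packets of a flow as coupons -/

/-- The probability that a packet is marked by `e_j`, or unmarked for `j = 0`, if `p = 1/n`. -/
noncomputable def letterProb (n : ℕ) (j : Fin (n + 1)) : ℝ :=
  if j = 0 then (1 - 1 / (n : ℝ)) ^ n else 1 / (n : ℝ) * (1 - 1 / (n : ℝ)) ^ ((j : ℕ) - 1)

/-- The probability that a packet is marked by the last edge `e_n`, the rarest one, if `p = 1/n`. -/
noncomputable def rarestProb (n : ℕ) : ℝ :=
  1 / (n : ℝ) * (1 - 1 / (n : ℝ)) ^ (n - 1)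

section LetterProb

variable {n : ℕ}

lemma one_sub_one_div_mem (hn : 2 ≤ n) : 0 ≤ 1 - 1 / (n : ℝ) ∧ 1 - 1 / (n : ℝ) ≤ 1 := by
  have hn2 : (2 : ℝ) ≤ n := by exact_mod_cast hn
  refine ⟨sub_nonneg.2 ?_, sub_le_self _ (by positivity)⟩
  rw [div_le_one (by linarith)]
  linarith

lemma rarestProb_le_letterProb (hn : 2 ≤ n) {j : Fin (n + 1)} (hj : j ≠ 0) :
    rarestProb n ≤ letterProb n j := by
  obtain ⟨h0, h1⟩ := one_sub_one_div_mem hn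
  rw [letterProb, if_neg hj, rarestProb]
  have hjn := j.isLt
  exact mul_le_mul_of_nonneg_left (pow_le_pow_of_le_one h0 h1 (by omega)) (by positivity)

lemma one_le_rarestProb_mul (hn : 2 ≤ n) : 1 ≤ rarestProb n * (Real.exp 1 * n) := by
  have hn0 : (0 : ℝ) < n := by positivity
  calc 1 = (Real.exp 1)⁻¹ * Real.exp 1 := (inv_mul_cancel₀ (Real.exp_pos 1).ne').symm
    _ ≤ (1 - 1 / (n : ℝ)) ^ (n - 1) * Real.exp 1 := by
      gcongr
      exact exp_neg_one_le_pow hn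
    _ = _ := by
      rw [rarestProb]
      field_simp

lemma letterProb_le (hn : 2 ≤ n) {j : Fin (n + 1)} (hj : j ≠ 0) :
    letterProb n j ≤ 3 * rarestProb n := by
  obtain ⟨h0, h1⟩ := one_sub_one_div_mem hn
  have hn0 : (0 : ℝ) < n := by positivity
  have h3 : 1 ≤ 3 * (1 - 1 / (n : ℝ)) ^ (n - 1) :=
    calc 1 = Real.exp 1 * (Real.exp 1)⁻¹ := (mul_inv_cancel₀ (Real.exp_pos 1).ne').symm
      _ ≤ 3 * (1 - 1 / (n : ℝ)) ^ (n - 1) := by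
        gcongr
        · exact Real.exp_one_lt_three.le
        · exact exp_neg_one_le_pow hn
  rw [letterProb, if_neg hj, rarestProb, mul_left_comm]
  exact mul_le_mul_of_nonneg_left ((pow_le_one₀ h0 h1).trans h3) (by positivity)

variable {Ω : Type*} [MeasurableSpace Ω] {μ : Measure Ω} {X : ℕ → Ω → Fin (n + 1)}

lemma IsFlow.measureReal_eq (hX : IsFlow (1 / (n : ℝ)) μ X) (t : ℕ) (j : Fin (n + 1)) :
    μ.real {ω | X t ω = j} = letterProb n j := by
  rw [letterProb]
  split_ifs with h
  · rw [h, hX.prob_dummy]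
  · exact hX.prob_proper t j h

lemma IsFlow.lintegral_incomplete_le [IsProbabilityMeasure μ] (hn : 2 ≤ n)
    (hX : IsFlow (1 / (n : ℝ)) μ X) :
    ∫⁻ ω, ∑' t, (if firstHops n n \ run gather ∅ (fun i => X i ω) t = ∅ then 0 else 1) ∂μ ≤
      ENNReal.ofReal (Real.exp 1 * n * (harmonic n : ℝ)) :=
  lintegral_tsum_incomplete_le (by positivity) (one_le_rarestProb_mul hn) hX.measurable hX.indep
    hX.measureReal_eq fun _ => rarestProb_le_letterProb hn

lemma IsFlow.measure_never_complete [IsProbabilityMeasure μ] (hn : 2 ≤ n)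
    (hX : IsFlow (1 / (n : ℝ)) μ X) :
    μ {ω | ¬ ∃ t, run gather ∅ (fun i => X i ω) t = firstHops n n} = 0 := by
  have hfin := ne_top_of_le_ne_top ENNReal.ofReal_ne_top (hX.lintegral_incomplete_le hn)
  refine measure_mono_null (fun ω hω => ?_) (measure_eq_top_of_lintegral_ne_top
    (Measurable.tsum (measurable_incomplete hX.measurable)).aemeasurable hfin)
  have hinc : ∀ t, firstHops n n \ run gather ∅ (fun i => X i ω) t ≠ ∅ := by
    refine fun t ht => hω ⟨t, Finset.Subset.antisymm (fun j hj => mem_firstHops_self.2 ?_)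
      (Finset.sdiff_eq_empty_iff_subset.1 ht)⟩
    rintro rfl
    exact zero_notMem_run_gather _ t hj
  change (∑' t, if firstHops n n \ run gather ∅ (fun i => X i ω) t = ∅ then (0 : ℝ≥0∞) else 1) = ∞
  simp only [if_neg (hinc _)]
  exact ENNReal.tsum_const_eq_top_of_ne_zero one_ne_zero

/-- The collection becomes complete without having passed through a proper prefix `{1, …, k}` with
`2 ≤ k` except with probability `O(n^{-1/3})`. -/
lemma IsFlow.le_measureReal_of_no_stray [IsProbabilityMeasure μ] (hn : 2 ≤ n)
    (hX : IsFlow (1 / (n : ℝ)) μ X) {A : Set Ω}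
    (hA : ∀ ω, (∃ t, run gather ∅ (fun i => X i ω) t = firstHops n n) →
      (∀ k ∈ Finset.Ico 2 n, ∀ t, run gather ∅ (fun i => X i ω) t ≠ firstHops n k) → ω ∈ A) :
    1 - 13 * (n : ℝ) ^ (-(1 / 3 : ℝ)) ≤ μ.real A := by
  have hpass : ∀ k ∈ Finset.Ico 2 n,
      μ {ω | ∃ t, run gather ∅ (fun i => X i ω) t = firstHops n k} ≤
        ENNReal.ofReal (passBound (n - k) k) := by
    intro k hk
    have hkn := (Finset.mem_Ico.1 hk).2.le
    have h := measure_exists_run_eq_le hX.measurable hX.indep hX.measureReal_eq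
      (fun _ => rarestProb_le_letterProb hn) (fun _ => letterProb_le hn)
      (firstHops_subset (n := n) (k := k))
    rwa [Finset.card_sdiff_of_subset firstHops_subset, card_firstHops le_rfl,
      card_firstHops hkn] at h
  have hsub : Aᶜ ⊆ {ω | ¬ ∃ t, run gather ∅ (fun i => X i ω) t = firstHops n n} ∪
      ⋃ k ∈ Finset.Ico 2 n, {ω | ∃ t, run gather ∅ (fun i => X i ω) t = firstHops n k} := by
    intro ω hω
    by_contra hnot
    rw [Set.mem_union, not_or] at hnot
    refine hω (hA ω (not_not.1 hnot.1) fun k hk t ht => hnot.2 ?_)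
    exact Set.mem_biUnion hk ⟨t, ht⟩
  have hcompl : μ Aᶜ ≤ ENNReal.ofReal (13 * (n : ℝ) ^ (-(1 / 3 : ℝ))) :=
    calc μ Aᶜ ≤ 0 + ∑ k ∈ Finset.Ico 2 n, ENNReal.ofReal (passBound (n - k) k) := by
          refine (measure_mono hsub).trans ((measure_union_le _ _).trans (add_le_add ?_ ?_))
          · exact (hX.measure_never_complete hn).le
          · exact (measure_biUnion_finset_le _ _).trans (Finset.sum_le_sum hpass)
      _ = ENNReal.ofReal (∑ k ∈ Finset.Ico 2 n, passBound (n - k) k) := by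
          rw [zero_add, ENNReal.ofReal_sum_of_nonneg fun k _ => (passBound_pos _ _).le]
      _ ≤ _ := ENNReal.ofReal_le_ofReal (sum_passBound_le hn)
  have hreal : μ.real Aᶜ ≤ 13 * (n : ℝ) ^ (-(1 / 3 : ℝ)) :=
    ENNReal.toReal_le_of_le_ofReal (by positivity) hcompl
  have hone : 1 ≤ μ.real A + μ.real Aᶜ := by
    rw [← probReal_univ (μ := μ), ← Set.union_compl_self A]
    exact measureReal_union_le A Aᶜ
  linarith

end LetterProb

end PPM

theorem theorem1 :
    (∃ C : ℝ, ∀ n : ℕ, 2 ≤ n →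
      ∀ (V : Type u) (N : SimpleGraph V) (v₀ vₙ : V) (P : N.Walk v₀ vₙ),
      P.IsPath → P.length = n →
      ∀ (Ω : Type v) [MeasurableSpace Ω] (μ : Measure Ω) [IsProbabilityMeasure μ]
        (X : ℕ → Ω → Fin (n + 1)), PPM.IsFlow (1 / (n : ℝ)) μ X →
      1 - C * PPM.rate n ≤ μ.real {ω | PPM.Returns P (fun t => X t ω) P}) ∧
    PPM.rate =o[atTop] (fun _ => (1 : ℝ)) ∧
    (∀ n : ℕ, 2 ≤ n →
      ∀ (V : Type u) (N : SimpleGraph V) (v₀ vₙ : V) (P : N.Walk v₀ vₙ),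
      P.IsPath → P.length = n →
      ∀ (Ω : Type v) [MeasurableSpace Ω] (μ : Measure Ω) [IsProbabilityMeasure μ]
        (X : ℕ → Ω → Fin (n + 1)), PPM.IsFlow (1 / (n : ℝ)) μ X →
      ∫⁻ ω, (PPM.stoppingTime P (fun t => X t ω) : ℝ≥0∞) ∂μ ≤
        ENNReal.ofReal (Real.exp 1 * n * (harmonic n : ℝ))) ∧
    (fun n : ℕ => Real.exp 1 * n * (harmonic n : ℝ) - Real.exp 1 * n * Real.log n)
      =O[atTop] (fun n : ℕ => (n : ℝ)) := by
  refine ⟨⟨13 * (Real.log 2 ^ (1 / (Real.exp 1 - 1)))⁻¹, ?_⟩, PPM.rate_isLittleO_one, ?_,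
    PPM.harmonic_sub_log_isBigO⟩
  · intro n hn V N v₀ vₙ P hP hlen Ω _ μ _ X hX
    have h := hX.le_measureReal_of_no_stray hn (A := {ω | PPM.Returns P (fun t => X t ω) P})
      fun ω hall hbad => PPM.returns_self hP hlen hn hall hbad
    have hr := PPM.rpow_neg_third_le_rate hn
    rw [mul_assoc]
    linarith
  · intro n hn V N v₀ vₙ P _ hlen Ω _ μ _ X hX
    exact (lintegral_mono fun ω => PPM.stoppingTime_le_tsum hlen hn _).trans
      (hX.lintegral_incomplete_le hn)
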